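/- Let $n\ge 1$, and let $P_n$ be the path with vertex set $[n]=\{1,\dots,n\}$ in which $j$ and $j+1$ are adjacent for $1\le j<n$. A permutation $\pi=\pi_1\pi_2\cdots\pi_n$ of $[n]$ is read as a history: at step $i$ the vertex $\pi_i$ is flipped from $-$ to $+$. An extra kink of $\pi$ is a step $i\ge 2$ such that no neighbour of $\pi_i$ in $P_n$ has been flipped before, that is, such that there is no $k<i$ with $|\pi_k-\pi_i|=1$. For $d\ge 0$ let $F_n^d$ be the set of permutations of $[n]$ with exactly $d$ extra kinks. **Theorem.** For every fixed integer $d\ge 0$, $$\#F_n^d\sim 2^{\,n-2d-1}(d+1)^n\qquad (n\to\infty),$$ that is, $$\lim_{n\to\infty}\frac{\#F_n^d}{2^{\,n-2d-1}(d+1)^n}=1 .$$ -/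

import Mathlib

open Filter Topology

/-- `IsHistoryStart π i`: at step `i` the vertex `π i` of the `n`-path is flipped from `-` to `+`
although none of its neighbours has been flipped at an earlier step. The permutation `π` lists the
vertices of the path in the order in which they are flipped; steps and vertices are numbered
`0, …, n - 1`, and `SimpleGraph.pathGraph n` is the graph in which consecutive vertices of
`0, …, n - 1` are adjacent. The first step is always of this kind. -/
def IsHistoryStart {n : ℕ} (π : Equiv.Perm (Fin n)) (i : Fin n) : Prop :=
  ∀ k : Fin n, k < i → ¬ (SimpleGraph.pathGraph n).Adj (π k) (π i)

/-- The number of extra kinks of the history `π`: the number of steps, not counting the first one,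
at which a vertex without a previously flipped neighbour is flipped. -/
noncomputable def numExtraKinks {n : ℕ} (π : Equiv.Perm (Fin n)) : ℕ :=
  Set.ncard {i : Fin n | 0 < (i : ℕ) ∧ IsHistoryStart π i}

/-- The set `F_n^d` of the histories of length `n` with exactly `d` extra kinks. -/
def historySet (n d : ℕ) : Set (Equiv.Perm (Fin n)) :=
  {π | numExtraKinks π = d}

open SimpleGraph

/-! Reading `π` through its inverse `σ`, which records when each vertex is flipped, history starts
become local minima (valleys) of `σ`. The first step is always one, so `d` extra kinks mean `d + 1`
valleys.

Every permutation arises uniquely by inserting a new minimum, which gives the recurrence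
`valleyCount_succ_succ`. With `w = (1 + X) / (1 - X)` and `z = 4 X / (1 + X) ^ 2`, the operator `2 X
d/dX` reproduces this recurrence, so that `w ^ (n + 1) * ∑ V(n, k) z ^ k = ∑ 2 (2 k) ^ n X ^ k` for
`n ≥ 1` (`mk_valley_series`).

As `z ^ k` has order `k`, the coefficient of `X ^ (d + 1)` involves only `V(n, 1), …, V(n, d + 1)`,
the last with factor `4 ^ (d + 1)`. The others carry factors polynomial in `n` and, by induction on
`d`, grow at most like `(2 d) ^ n`. Hence `V(n, d + 1) ∼ 2 (2 (d + 1)) ^ n / 4 ^ (d + 1)`. -/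

/-- The valleys of a permutation of the vertices of a path: the vertices whose label is smaller
than the labels of all their neighbours. -/
def valleys {n : ℕ} (σ : Equiv.Perm (Fin n)) : Finset (Fin n) :=
  Finset.univ.filter fun v => ∀ u : Fin n, (u : ℕ) + 1 = v ∨ (v : ℕ) + 1 = u → σ v < σ u

theorem mem_valleys {n : ℕ} {σ : Equiv.Perm (Fin n)} {v : Fin n} :
    v ∈ valleys σ ↔ ∀ u : Fin n, (u : ℕ) + 1 = v ∨ (v : ℕ) + 1 = u → σ v < σ u := by
  simp [valleys]

/-- The number of permutations of `Fin n` with exactly `k` valleys. -/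
def valleyCount (n k : ℕ) : ℕ :=
  (Finset.univ.filter fun σ : Equiv.Perm (Fin n) => (valleys σ).card = k).card

/-! ### Inserting a new minimum and the recurrence -/

/-- The permutation obtained from `τ` by inserting a new vertex `v` carrying a new smallest
label. -/
def insertMin {n : ℕ} (v : Fin (n + 1)) (τ : Equiv.Perm (Fin n)) : Equiv.Perm (Fin (n + 1)) :=
  (finSuccEquiv' v).trans ((Equiv.optionCongr τ).trans (finSuccEquiv' 0).symm)

theorem insertMin_self {n : ℕ} (v : Fin (n + 1)) (τ : Equiv.Perm (Fin n)) :
    insertMin v τ v = 0 := by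
  simp [insertMin]

theorem insertMin_succAbove {n : ℕ} (v : Fin (n + 1)) (τ : Equiv.Perm (Fin n)) (u : Fin n) :
    insertMin v τ (v.succAbove u) = (τ u).succ := by
  simp [insertMin]

theorem insertMin_bijective (n : ℕ) :
    Function.Bijective fun p : Fin (n + 1) × Equiv.Perm (Fin n) => insertMin p.1 p.2 := by
  rw [Fintype.bijective_iff_injective_and_card]
  refine ⟨?_, by simp [Fintype.card_perm, Nat.factorial_succ]⟩
  rintro ⟨v, τ⟩ ⟨w, ρ⟩ h
  simp only at h
  have hvw : v = w := by
    apply (insertMin w ρ).injective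
    rw [insertMin_self, ← h, insertMin_self]
  subst hvw
  congr 1
  ext1 u
  have := congrArg (fun σ : Equiv.Perm (Fin (n + 1)) => σ (v.succAbove u)) h
  simpa [insertMin_succAbove] using this

theorem self_mem_valleys_insertMin {n : ℕ} (v : Fin (n + 1)) (τ : Equiv.Perm (Fin n)) :
    v ∈ valleys (insertMin v τ) := by
  rw [mem_valleys]
  intro u hu
  obtain rfl | ⟨u, rfl⟩ := v.eq_self_or_eq_succAbove u
  · omega
  · rw [insertMin_self, insertMin_succAbove]
    exact Fin.succ_pos _

theorem val_succAbove {n : ℕ} (v : Fin (n + 1)) (u : Fin n) :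
    (v.succAbove u : ℕ) = if (u : ℕ) < v then (u : ℕ) else u + 1 := by
  simp only [Fin.succAbove, Fin.lt_def, Fin.val_castSucc]
  split_ifs <;> simp

theorem succAbove_mem_valleys_insertMin {n : ℕ} (v : Fin (n + 1)) (τ : Equiv.Perm (Fin n))
    (u : Fin n) : v.succAbove u ∈ valleys (insertMin v τ) ↔
      u ∈ valleys τ ∧ u.castSucc ≠ v ∧ u.succ ≠ v := by
  rw [mem_valleys, mem_valleys]
  have hu := val_succAbove v u
  constructor
  · intro h
    have h1 : ¬ ((v : ℕ) + 1 = v.succAbove u ∨ (v.succAbove u : ℕ) + 1 = v) := by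
      intro hv
      have := h v hv
      rw [insertMin_self] at this
      exact absurd this (Fin.not_lt_zero _)
    have h2 : (u : ℕ) ≠ v ∧ (u : ℕ) + 1 ≠ v := by
      split_ifs at hu <;> omega
    refine ⟨fun x hx => ?_, fun e => h2.1 (by rw [← e]; simp), fun e => h2.2 (by rw [← e]; simp)⟩
    have hx' := val_succAbove v x
    have := h (v.succAbove x) (by split_ifs at hu hx' <;> omega)
    simpa [insertMin_succAbove] using this
  · rintro ⟨h, h1, h2⟩ x hx
    rw [Ne, Fin.ext_iff, Fin.val_castSucc] at h1
    rw [Ne, Fin.ext_iff, Fin.val_succ] at h2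
    obtain rfl | ⟨x, rfl⟩ := v.eq_self_or_eq_succAbove x
    · split_ifs at hu <;> omega
    · have hx' := val_succAbove v x
      have := h x (by split_ifs at hu hx' <;> omega)
      simpa [insertMin_succAbove] using this

theorem valleys_insertMin {n : ℕ} (v : Fin (n + 1)) (τ : Equiv.Perm (Fin n)) :
    valleys (insertMin v τ) = insert v
      (((valleys τ).filter fun u => u.castSucc ≠ v ∧ u.succ ≠ v).map v.succAboveEmb) := by
  ext x
  obtain rfl | ⟨x, rfl⟩ := v.eq_self_or_eq_succAbove x
  · simp [self_mem_valleys_insertMin]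
  · simp [succAbove_mem_valleys_insertMin, Fin.succAbove_ne]

/-- The gaps of a path next to a valley. -/
def valleyGaps {n : ℕ} (τ : Equiv.Perm (Fin n)) : Finset (Fin (n + 1)) :=
  (valleys τ).map Fin.castSuccEmb ∪ (valleys τ).map (Fin.succEmb n)

theorem mem_valleyGaps {n : ℕ} {τ : Equiv.Perm (Fin n)} {v : Fin (n + 1)} :
    v ∈ valleyGaps τ ↔ ∃ u ∈ valleys τ, u.castSucc = v ∨ u.succ = v := by
  simp only [valleyGaps, Finset.mem_union, Finset.mem_map]
  constructor
  · rintro (⟨u, h, e⟩ | ⟨u, h, e⟩)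
    exacts [⟨u, h, .inl e⟩, ⟨u, h, .inr e⟩]
  · rintro ⟨u, h, e | e⟩
    exacts [.inl ⟨u, h, e⟩, .inr ⟨u, h, e⟩]

theorem not_adjacent_valleys {n : ℕ} {τ : Equiv.Perm (Fin n)} {u v : Fin n}
    (hu : u ∈ valleys τ) (hv : v ∈ valleys τ) : (u : ℕ) + 1 ≠ v := by
  intro h
  exact lt_asymm (mem_valleys.1 hu v (.inr h)) (mem_valleys.1 hv u (.inl h))

theorem card_valleyGaps {n : ℕ} (τ : Equiv.Perm (Fin n)) :
    (valleyGaps τ).card = 2 * (valleys τ).card := by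
  rw [valleyGaps, Finset.card_union_of_disjoint, Finset.card_map, Finset.card_map, two_mul]
  rw [Finset.disjoint_left]
  intro x hx hx'
  obtain ⟨a, ha, rfl⟩ := Finset.mem_map.1 hx
  obtain ⟨b, hb, e⟩ := Finset.mem_map.1 hx'
  exact not_adjacent_valleys hb ha (by simpa [Fin.ext_iff] using e)

/-- The new minimum is a valley and destroys any valley beside it. Valleys are never adjacent, so at
most one is lost. -/
theorem card_valleys_insertMin {n : ℕ} (v : Fin (n + 1)) (τ : Equiv.Perm (Fin n)) :
    (valleys (insertMin v τ)).card =
      if v ∈ valleyGaps τ then (valleys τ).card else (valleys τ).card + 1 := by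
  rw [valleys_insertMin, Finset.card_insert_of_notMem (by simp [Fin.succAbove_ne]),
    Finset.card_map]
  split_ifs with h
  · obtain ⟨u, hu, huv⟩ := mem_valleyGaps.1 h
    have : ((valleys τ).filter fun u => u.castSucc ≠ v ∧ u.succ ≠ v) = (valleys τ).erase u := by
      ext x
      simp only [Finset.mem_filter, Finset.mem_erase]
      constructor
      · rintro ⟨hx, h1, h2⟩
        refine ⟨?_, hx⟩
        rintro rfl
        tauto
      · rintro ⟨hne, hx⟩
        have h1 := not_adjacent_valleys hu hx
        have h2 := not_adjacent_valleys hx hu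
        simp only [Fin.ext_iff, Fin.val_castSucc, Fin.val_succ, Ne] at *
        refine ⟨hx, ?_, ?_⟩ <;> omega
    rw [this, Finset.card_erase_add_one hu]
  · rw [Finset.filter_true_of_mem]
    intro u hu
    by_contra hcon
    exact h (mem_valleyGaps.2 ⟨u, hu, by tauto⟩)

theorem card_valleys_insertMin_pos {n : ℕ} (v : Fin (n + 1)) (τ : Equiv.Perm (Fin n)) :
    0 < (valleys (insertMin v τ)).card :=
  Finset.card_pos.2 ⟨v, self_mem_valleys_insertMin v τ⟩

theorem valleyCount_succ_zero (n : ℕ) : valleyCount (n + 1) 0 = 0 := by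
  rw [valleyCount, Finset.card_eq_zero, Finset.filter_eq_empty_iff]
  intro σ _
  obtain ⟨⟨v, τ⟩, rfl⟩ := (insertMin_bijective n).2 σ
  exact (card_valleys_insertMin_pos v τ).ne'

theorem valleyCount_zero_zero : valleyCount 0 0 = 1 := by
  simp [valleyCount, valleys]

theorem valleyCount_eq_zero {n k : ℕ} (h : n < k) : valleyCount n k = 0 := by
  rw [valleyCount, Finset.card_eq_zero, Finset.filter_eq_empty_iff]
  intro σ _ e
  have := Finset.card_le_univ (valleys σ)
  rw [Fintype.card_fin] at this
  omega

theorem card_filter_insertMin {n : ℕ} (k : ℕ) (τ : Equiv.Perm (Fin n)) :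
    ((Finset.univ.filter fun v => (valleys (insertMin v τ)).card = k + 1).card : ℝ) =
      (if (valleys τ).card = k + 1 then 2 * ((k : ℝ) + 1) else 0) +
        if (valleys τ).card = k then (n : ℝ) + 1 - 2 * k else 0 := by
  simp only [card_valleys_insertMin]
  have hg := card_valleyGaps τ
  by_cases h1 : (valleys τ).card = k + 1
  · have : (Finset.univ.filter fun v => (if v ∈ valleyGaps τ then (valleys τ).card
        else (valleys τ).card + 1) = k + 1) = valleyGaps τ := by
      ext v
      by_cases hv : v ∈ valleyGaps τ <;> simp [hv, h1]
    rw [this, hg, h1]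
    simp
  · by_cases h2 : (valleys τ).card = k
    · have : (Finset.univ.filter fun v => (if v ∈ valleyGaps τ then (valleys τ).card
          else (valleys τ).card + 1) = k + 1) = (valleyGaps τ)ᶜ := by
        ext v
        by_cases hv : v ∈ valleyGaps τ <;> simp [hv, h2]
      rw [this, Finset.card_compl, Nat.cast_sub (Finset.card_le_univ _), hg, h2]
      simp
    · rw [Finset.filter_false_of_mem]
      · simp [h1, h2]
      · intro v _
        split_ifs <;> omega

/-- Of the `n + 1` gaps, `2 k` touch one of `k` valleys. The identity lives in `ℝ` because `n + 1 -
2 k` may be negative; `V(n, k)` is then zero. -/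
theorem valleyCount_succ_succ (n k : ℕ) :
    (valleyCount (n + 1) (k + 1) : ℝ) =
      2 * ((k : ℝ) + 1) * valleyCount n (k + 1) + ((n : ℝ) + 1 - 2 * k) * valleyCount n k := by
  have h : valleyCount (n + 1) (k + 1) = ∑ τ : Equiv.Perm (Fin n),
      (Finset.univ.filter fun v => (valleys (insertMin v τ)).card = k + 1).card := by
    simp only [valleyCount, Finset.card_filter]
    rw [← (Equiv.ofBijective _ (insertMin_bijective n)).sum_comp, Fintype.sum_prod_type_right]
    rfl
  rw [h, Nat.cast_sum]
  simp only [card_filter_insertMin, Finset.sum_add_distrib, ← Finset.sum_filter, Finset.sum_const,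
    nsmul_eq_mul, valleyCount]
  ring

/-! ### Histories and valleys -/

theorem isHistoryStart_iff {n : ℕ} (π : Equiv.Perm (Fin n)) (i : Fin n) :
    IsHistoryStart π i ↔ π i ∈ valleys π.symm := by
  rw [mem_valleys, IsHistoryStart]
  simp only [pathGraph_adj, Equiv.symm_apply_apply]
  constructor
  · intro h u hu
    by_contra hcon
    rcases (not_lt.1 hcon).lt_or_eq with hlt | heq
    · exact h _ hlt (by simpa using hu)
    · have : u = π i := by rw [← heq, Equiv.apply_symm_apply]
      subst this
      omega
  · intro h k hk hadj
    have := h (π k) hadj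
    rw [Equiv.symm_apply_apply] at this
    exact lt_asymm hk this

theorem numExtraKinks_add_one {n : ℕ} (π : Equiv.Perm (Fin (n + 1))) :
    numExtraKinks π + 1 = (valleys π.symm).card := by
  have h0 : π 0 ∈ valleys π.symm := by
    rw [← isHistoryStart_iff]
    intro k hk
    exact absurd hk (Fin.not_lt_zero _)
  have : {i : Fin (n + 1) | 0 < (i : ℕ) ∧ IsHistoryStart π i} =
      (((valleys π.symm).erase (π 0)).map π.symm.toEmbedding : Finset (Fin (n + 1))) := by
    ext i
    simp only [Set.mem_ofPred_eq, isHistoryStart_iff, Finset.mem_coe, Finset.mem_map_equiv,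
      Equiv.symm_symm, Finset.mem_erase, ne_eq, EmbeddingLike.apply_eq_iff_eq, Fin.ext_iff,
      Nat.pos_iff_ne_zero, Fin.val_zero]
  rw [numExtraKinks, this, Set.ncard_coe_finset, Finset.card_map, Finset.card_erase_add_one h0]

theorem ncard_historySet (n d : ℕ) : (historySet (n + 1) d).ncard = valleyCount (n + 1) (d + 1) := by
  have : historySet (n + 1) d = (((Finset.univ.filter fun σ : Equiv.Perm (Fin (n + 1)) =>
      (valleys σ).card = d + 1).map (Equiv.inv (Equiv.Perm (Fin (n + 1)))).toEmbedding :
        Finset (Equiv.Perm (Fin (n + 1)))) : Set (Equiv.Perm (Fin (n + 1)))) := by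
    ext π
    have h := numExtraKinks_add_one π
    simp only [historySet, Set.mem_ofPred_eq, Finset.coe_map, Set.mem_image, Finset.mem_coe,
      Finset.mem_filter, Finset.mem_univ, true_and]
    constructor
    · intro hd
      exact ⟨π.symm, by omega, rfl⟩
    · rintro ⟨σ, hσ, rfl⟩
      change numExtraKinks σ.symm = d
      change numExtraKinks σ.symm + 1 = (valleys σ).card at h
      omega
  rw [this, Set.ncard_coe_finset, Finset.card_map, valleyCount]

/-! ### The generating function of a row -/

section GeneratingFunction

open PowerSeries

/-- The power series `(1 + X) / (1 - X)`. -/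
noncomputable def cayleySeries : ℝ⟦X⟧ := (1 + X) * (1 - X)⁻¹

/-- The power series `4 X / (1 + X) ^ 2`. -/
noncomputable def koebeSeries : ℝ⟦X⟧ := X * (4 * ((1 + X)⁻¹) ^ 2)

theorem one_add_X_mul_inv : (1 + X : ℝ⟦X⟧) * (1 + X)⁻¹ = 1 :=
  PowerSeries.mul_inv_cancel _ (by simp)

theorem one_sub_X_mul_inv : (1 - X : ℝ⟦X⟧) * (1 - X)⁻¹ = 1 :=
  PowerSeries.mul_inv_cancel _ (by simp)

theorem cayleySeries_mul : cayleySeries * (1 - X) = 1 + X := by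
  rw [cayleySeries]
  linear_combination (1 + X : ℝ⟦X⟧) * one_sub_X_mul_inv

theorem koebeSeries_mul : koebeSeries * (1 + X) ^ 2 = 4 * X := by
  have h := one_add_X_mul_inv
  have : ((1 + X : ℝ⟦X⟧) * (1 + X)⁻¹) ^ 2 = 1 := by rw [h, one_pow]
  rw [koebeSeries]
  linear_combination 4 * X * this

theorem one_sub_X_ne_zero : (1 - X : ℝ⟦X⟧) ≠ 0 := fun h => by
  simpa using congrArg (constantCoeff (R := ℝ)) h

theorem one_add_X_ne_zero : (1 + X : ℝ⟦X⟧) ≠ 0 := fun h => by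
  simpa using congrArg (constantCoeff (R := ℝ)) h

theorem cayleySeries_sq_mul_koebeSeries :
    cayleySeries ^ 2 * koebeSeries = cayleySeries ^ 2 - 1 := by
  have h1 := cayleySeries_mul
  have h2 := koebeSeries_mul
  have h3 : (cayleySeries * (1 - X)) ^ 2 = (1 + X) ^ 2 := by rw [h1]
  apply mul_right_cancel₀ (pow_ne_zero 2 one_sub_X_ne_zero)
  linear_combination (koebeSeries - 1) * h3 + h2

theorem two_mul_X_mul_derivative_cayleySeries :
    2 * X * d⁄dX ℝ cayleySeries = cayleySeries ^ 2 - 1 := by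
  have h1 := cayleySeries_mul
  have h2 := congrArg (d⁄dX ℝ) h1
  simp only [Derivation.leibniz, map_add, map_sub, Derivation.map_one_eq_zero, derivative_X,
    smul_eq_mul] at h2
  have h3 : (cayleySeries * (1 - X)) ^ 2 = (1 + X) ^ 2 := by rw [h1]
  apply mul_right_cancel₀ (pow_ne_zero 2 one_sub_X_ne_zero)
  linear_combination 2 * X * (1 - X) * h2 - h3 + 2 * X * h1

theorem cayleySeries_mul_X_mul_derivative_koebeSeries :
    cayleySeries * (X * d⁄dX ℝ koebeSeries) = koebeSeries := by
  have h1 := cayleySeries_mul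
  have h2 := congrArg (d⁄dX ℝ) koebeSeries_mul
  have h4 : (4 : ℝ⟦X⟧) = C 4 := (map_ofNat C 4).symm
  rw [h4] at h2
  simp only [Derivation.leibniz, Derivation.leibniz_pow, map_add, Derivation.map_one_eq_zero,
    derivative_X, derivative_C, smul_eq_mul, nsmul_eq_mul] at h2
  rw [← h4] at h2
  have h3 := koebeSeries_mul
  apply mul_right_cancel₀ (mul_ne_zero (pow_ne_zero 3 one_add_X_ne_zero) one_sub_X_ne_zero)
  linear_combination (X * d⁄dX ℝ koebeSeries * (1 + X) ^ 3) * h1 + (1 + X) ^ 2 * X * h2 -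
    (1 + X) ^ 2 * h3

/-- Follows from `w ^ 2 z = w ^ 2 - 1 = 2 X w'` and `w X z' = z`. The two summands are the two ways
of inserting a minimum. -/
theorem two_mul_X_mul_derivative_pow_mul_pow (n k : ℕ) :
    2 * X * d⁄dX ℝ (cayleySeries ^ (n + 1) * koebeSeries ^ k) =
      cayleySeries ^ (n + 2) *
        (2 * (k : ℝ⟦X⟧) * koebeSeries ^ k + ((n : ℝ⟦X⟧) + 1 - 2 * (k : ℝ⟦X⟧)) * koebeSeries ^ (k + 1)) := by
  have h1 := cayleySeries_sq_mul_koebeSeries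
  have h2 := two_mul_X_mul_derivative_cayleySeries
  have h3 := cayleySeries_mul_X_mul_derivative_koebeSeries
  simp only [Derivation.leibniz, Derivation.leibniz_pow, smul_eq_mul, nsmul_eq_mul,
    Nat.add_sub_cancel]
  rcases k with _ | k
  · push_cast
    simp only [pow_zero, pow_one]
    linear_combination (n + 1 : ℝ⟦X⟧) * cayleySeries ^ n * (h2 - h1)
  · rw [Nat.add_sub_cancel]
    push_cast
    linear_combination (n + 1 : ℝ⟦X⟧) * cayleySeries ^ n * koebeSeries ^ (k + 1) * (h2 - h1) +
      2 * (k + 1 : ℝ⟦X⟧) * cayleySeries ^ n * koebeSeries ^ k * h3 +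
      2 * (k + 1 : ℝ⟦X⟧) * cayleySeries ^ n * koebeSeries ^ (k + 1) * h1

theorem sum_valleyCount_succ (n M : ℕ) (hM : n < M) (z : ℝ⟦X⟧) :
    ∑ k ∈ Finset.range (M + 1), C (valleyCount (n + 1) k : ℝ) * z ^ k =
      ∑ k ∈ Finset.range (M + 1), C (valleyCount n k : ℝ) *
        (2 * (k : ℝ⟦X⟧) * z ^ k + ((n : ℝ⟦X⟧) + 1 - 2 * (k : ℝ⟦X⟧)) * z ^ (k + 1)) := by
  have hR : ∑ k ∈ Finset.range (M + 1), C (valleyCount n k : ℝ) *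
        (2 * (k : ℝ⟦X⟧) * z ^ k + ((n : ℝ⟦X⟧) + 1 - 2 * (k : ℝ⟦X⟧)) * z ^ (k + 1)) =
      ∑ k ∈ Finset.range (M + 1), C (valleyCount n k : ℝ) * (2 * (k : ℝ⟦X⟧) * z ^ k) +
      ∑ k ∈ Finset.range (M + 1), C (valleyCount n k : ℝ) *
        (((n : ℝ⟦X⟧) + 1 - 2 * (k : ℝ⟦X⟧)) * z ^ (k + 1)) := by
    rw [← Finset.sum_add_distrib]
    exact Finset.sum_congr rfl fun k _ => by ring
  rw [hR, Finset.sum_range_succ', valleyCount_succ_zero, Finset.sum_range_succ',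
    Finset.sum_range_succ _ M, valleyCount_eq_zero hM]
  simp only [Nat.cast_zero, map_zero, zero_mul, mul_zero, add_zero]
  rw [← Finset.sum_add_distrib]
  refine Finset.sum_congr rfl fun k _ => ?_
  rw [valleyCount_succ_succ]
  simp only [map_add, map_mul, map_sub, map_natCast, map_one, map_ofNat]
  push_cast
  ring

theorem mk_valley_series (n : ℕ) : ∀ M : ℕ, n < M →
    cayleySeries ^ (n + 1) * ∑ k ∈ Finset.range M, C (valleyCount n k : ℝ) * koebeSeries ^ k =
      PowerSeries.mk fun k => if k = 0 then (0 : ℝ) ^ n else 2 * (2 * (k : ℝ)) ^ n := by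
  induction n with
  | zero =>
    intro M hM
    obtain ⟨M, rfl⟩ := Nat.exists_eq_succ_of_ne_zero hM.ne'
    have : ∑ k ∈ Finset.range M, C (valleyCount 0 (k + 1) : ℝ) * koebeSeries ^ (k + 1) = 0 :=
      Finset.sum_eq_zero fun k _ => by rw [valleyCount_eq_zero (Nat.succ_pos k)]; simp
    rw [Nat.succ_eq_add_one, Finset.sum_range_succ', this, valleyCount_zero_zero]
    -- The base case is `w = 1 + 2 X + 2 X ^ 2 + ⋯`; here `0 ^ 0 = 1` supplies the constant term.
    apply mul_right_cancel₀ one_sub_X_ne_zero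
    have h1 := cayleySeries_mul
    simp only [zero_add, pow_one, Nat.cast_one, map_one, pow_zero, mul_one]
    rw [h1]
    ext m
    rw [mul_sub, mul_one, map_sub, coeff_mk, map_add]
    rcases m with _ | _ | m
    · simp
    · simp [coeff_succ_mul_X, coeff_X, coeff_one]; norm_num
    · rw [coeff_succ_mul_X]
      simp [coeff_X, coeff_one]
  | succ n ih =>
    intro M hM
    obtain ⟨M, rfl⟩ := Nat.exists_eq_succ_of_ne_zero (Nat.zero_lt_of_lt hM).ne'
    rw [Nat.succ_eq_add_one, sum_valleyCount_succ n M (by omega)]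
    have h := congrArg (fun f => 2 * X * d⁄dX ℝ f) (ih (M + 1) (by omega))
    have hC : ∀ a : ℝ, ∀ f : ℝ⟦X⟧, 2 * X * d⁄dX ℝ (C a * f) = C a * (2 * X * d⁄dX ℝ f) := by
      intro a f
      rw [Derivation.leibniz, derivative_C]
      simp only [smul_eq_mul]
      ring
    rw [Finset.mul_sum, map_sum, Finset.mul_sum] at h
    rw [Finset.mul_sum]
    trans 2 * X * d⁄dX ℝ (PowerSeries.mk fun k => if k = 0 then (0 : ℝ) ^ n else 2 * (2 * (k : ℝ)) ^ n)
    · rw [← h]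
      refine Finset.sum_congr rfl fun k _ => ?_
      rw [mul_left_comm (cayleySeries ^ (n + 1)), hC, two_mul_X_mul_derivative_pow_mul_pow]
      ring
    · ext m
      rw [show (2 : ℝ⟦X⟧) = C 2 from (map_ofNat C 2).symm, mul_assoc, coeff_C_mul, coeff_mk]
      rcases m with _ | m
      · simp
      · rw [coeff_succ_X_mul, coeff_derivative, coeff_mk]
        simp only [Nat.add_eq_zero_iff, one_ne_zero, and_false, if_false]
        push_cast
        ring

/-! ### Coefficient extraction and asymptotics -/

theorem X_dvd_cayleySeries_sub_one : X ∣ cayleySeries - 1 := by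
  rw [X_dvd_iff]
  simp [cayleySeries]

/-- Expand `(1 + (w - 1)) ^ n`: terms with `m > i` are divisible by `X ^ (i + 1)`. The number of
terms thus does not depend on `n`, and each is polynomial in `n`. -/
theorem coeff_pow_mul {R : Type*} [CommRing R] {w : R⟦X⟧} (hw : X ∣ w - 1) (g : R⟦X⟧) (i n : ℕ) :
    coeff i (w ^ n * g) =
      ∑ m ∈ Finset.range (i + 1), (n.choose m : R) * coeff i ((w - 1) ^ m * g) := by
  have h : coeff i (w ^ n * g) =
      ∑ m ∈ Finset.range (n + 1), (n.choose m : R) * coeff i ((w - 1) ^ m * g) := by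
    conv_lhs => rw [← sub_add_cancel w 1, add_pow, Finset.sum_mul, map_sum]
    refine Finset.sum_congr rfl fun m _ => ?_
    rw [one_pow, mul_one, mul_right_comm, mul_comm, ← map_natCast (C (R := R)), coeff_C_mul]
  rw [h]
  have hn : Finset.range (n + 1) ⊆ Finset.range (max n i + 1) :=
    Finset.range_subset_range.2 (by omega)
  have hi : Finset.range (i + 1) ⊆ Finset.range (max n i + 1) :=
    Finset.range_subset_range.2 (by omega)
  rw [Finset.sum_subset hn, Finset.sum_subset hi]
  · intro m _ hm
    have hdvd : X ^ m ∣ (w - 1) ^ m * g := (pow_dvd_pow_of_dvd hw m).mul_right g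
    rw [X_pow_dvd_iff.1 hdvd i (by simpa using hm), mul_zero]
  · intro m _ hm
    rw [Nat.choose_eq_zero_of_lt (by simpa using hm), Nat.cast_zero, zero_mul]

theorem tendsto_coeff_pow_mul {w : ℝ⟦X⟧} (hw : X ∣ w - 1) (g : ℝ⟦X⟧) (i : ℕ) {r : ℝ}
    (hr0 : 0 ≤ r) (hr1 : r < 1) :
    Tendsto (fun n : ℕ => coeff i (w ^ n * g) * r ^ n) atTop (𝓝 0) := by
  simp only [coeff_pow_mul hw, Finset.sum_mul]
  rw [← Finset.sum_const_zero (s := Finset.range (i + 1))]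
  refine tendsto_finsetSum _ fun m _ => ?_
  have h : Tendsto (fun n : ℕ => (n.choose m : ℝ) * r ^ n) atTop (𝓝 0) := by
    refine squeeze_zero (fun n => by positivity) (fun n => ?_)
      (tendsto_pow_const_mul_const_pow_of_lt_one m hr0 hr1)
    gcongr
    exact_mod_cast Nat.choose_le_pow n m
  simpa [mul_right_comm] using h.mul_const (coeff i ((w - 1) ^ m * g))

theorem coeff_mul_koebeSeries_pow_self (k : ℕ) (f : ℝ⟦X⟧) :
    coeff k (f * koebeSeries ^ k) = 4 ^ k * constantCoeff f := by
  rw [koebeSeries, mul_pow, mul_left_comm, coeff_X_pow_mul']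
  simp [mul_comm, map_ofNat]

theorem coeff_mul_koebeSeries_pow_of_lt {i k : ℕ} (h : i < k) (f : ℝ⟦X⟧) :
    coeff i (f * koebeSeries ^ k) = 0 := by
  rw [koebeSeries, mul_pow, mul_left_comm, coeff_X_pow_mul', if_neg (by omega)]

theorem sum_valleyCount_mul_coeff {n : ℕ} (hn : n ≠ 0) (d : ℕ) :
    ∑ j ∈ Finset.range d, (valleyCount n (j + 1) : ℝ) *
        coeff (d + 1) (cayleySeries ^ (n + 1) * koebeSeries ^ (j + 1)) +
      4 ^ (d + 1) * valleyCount n (d + 1) = 2 * (2 * ((d : ℝ) + 1)) ^ n := by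
  obtain ⟨n, rfl⟩ := Nat.exists_eq_succ_of_ne_zero hn
  have h := congrArg (coeff (d + 1)) (mk_valley_series (n + 1) (n + 1 + 1 + (d + 2)) (by omega))
  have hs : Finset.range (d + 2) ⊆ Finset.range (n + 1 + 1 + (d + 2)) :=
    Finset.range_subset_range.2 (by omega)
  rw [Finset.mul_sum, map_sum, coeff_mk] at h
  simp only [mul_left_comm _ (C _), coeff_C_mul] at h
  rw [← Finset.sum_subset hs, Finset.sum_range_succ', Finset.sum_range_succ,
    coeff_mul_koebeSeries_pow_self, valleyCount_succ_zero] at h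
  · simp [cayleySeries] at h
    simp only [Nat.succ_eq_add_one, cayleySeries]
    linear_combination h
  · intro k _ hk
    rw [coeff_mul_koebeSeries_pow_of_lt (by simpa [Nat.succ_le_iff] using hk), mul_zero]

theorem tendsto_valleyCount (d : ℕ) :
    Tendsto (fun n : ℕ => (valleyCount n (d + 1) : ℝ) / (2 * ((d : ℝ) + 1)) ^ n) atTop
      (𝓝 (2 / 4 ^ (d + 1))) := by
  induction d using Nat.strong_induction_on with
  | _ d ih =>
    have hterm : ∀ j ∈ Finset.range d, Tendsto (fun n : ℕ => (valleyCount n (j + 1) : ℝ) *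
        coeff (d + 1) (cayleySeries ^ (n + 1) * koebeSeries ^ (j + 1)) /
          (2 * ((d : ℝ) + 1)) ^ n) atTop (𝓝 0) := by
      intro j hj
      have hjd : (j : ℝ) < d := by exact_mod_cast Finset.mem_range.1 hj
      -- The ratio `r = (j + 1) / (d + 1) < 1` turns the normalisation for `j` into that for `d`,
      -- and beats the polynomial coefficient.
      have h := (ih j (Finset.mem_range.1 hj)).mul
        (tendsto_coeff_pow_mul X_dvd_cayleySeries_sub_one (cayleySeries * koebeSeries ^ (j + 1))
          (d + 1) (r := (2 * ((j : ℝ) + 1)) / (2 * ((d : ℝ) + 1))) (by positivity)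
          (by rw [div_lt_one (by positivity)]; linarith))
      rw [mul_zero] at h
      refine h.congr fun n => ?_
      have h1 : (2 * ((j : ℝ) + 1)) ^ n ≠ 0 := by positivity
      have h2 : (2 * ((d : ℝ) + 1)) ^ n ≠ 0 := by positivity
      rw [← mul_assoc (cayleySeries ^ n), ← pow_succ, div_pow]
      field_simp
    have hsum := ((tendsto_finsetSum _ hterm).const_sub 2).div_const (4 ^ (d + 1))
    rw [Finset.sum_const_zero, sub_zero] at hsum
    refine hsum.congr' ?_
    filter_upwards [eventually_ne_atTop 0] with n hn
    have h := sum_valleyCount_mul_coeff hn d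
    have h2 : (2 * ((d : ℝ) + 1)) ^ n ≠ 0 := by positivity
    rw [← Finset.sum_div, eq_sub_of_add_eq h]
    field_simp
    ring

end GeneratingFunction

theorem mainTheorem2 (d : ℕ) :
    Tendsto
      (fun n : ℕ =>
        ((historySet n d).ncard : ℝ) /
          ((2 : ℝ) ^ ((n : ℤ) - 2 * (d : ℤ) - 1) * ((d : ℝ) + 1) ^ n))
      atTop (𝓝 1) := by
  have h := (tendsto_valleyCount d).mul_const ((4 : ℝ) ^ (d + 1) / 2)
  rw [div_mul_div_cancel₀ (by positivity), div_self two_ne_zero] at h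
  refine h.congr' ?_
  filter_upwards [eventually_ne_atTop 0] with n hn
  obtain ⟨n, rfl⟩ := Nat.exists_eq_succ_of_ne_zero hn
  have hpow : (2 : ℝ) ^ (((n + 1 : ℕ) : ℤ) - 2 * (d : ℤ) - 1) = 2 ^ (n + 1) * 2 / 4 ^ (d + 1) := by
    have h4 : (4 : ℝ) ^ (d + 1) = 2 ^ (2 * (d + 1)) := by rw [pow_mul]; norm_num
    rw [h4, eq_div_iff (by positivity), ← zpow_natCast, ← zpow_natCast, ← zpow_add₀ two_ne_zero,
      ← zpow_add_one₀ two_ne_zero]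
    congr 1
    push_cast
    ring
  rw [Nat.succ_eq_add_one, ncard_historySet, hpow, mul_pow]
  field_simp
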